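/- Let $\gamma\in\mathbb{R}$ and $-1<m\le-\tfrac12$. Consider the boundary value problem $$f'''+(m+2)ff''-(2m+1)f'^2=0 \ \text{ on } [0,\infty),\qquad f(0)=-\gamma,\qquad f''(0)=-1,\qquad \lim_{t\to\infty}f'(t)=0$$ for three times continuously differentiable functions $f:[0,\infty)\to\mathbb{R}$ (with one-sided derivatives at $0$). This problem admits a bounded solution $f$ which is positive at infinity (that is, $f(t)>0$ for all sufficiently large $t$), strictly increasing, strictly concave, and satisfies $$\forall t\ge 0,\qquad -\gamma\le f(t)\le\sqrt{\gamma^2+\frac{2f'(0)}{m+2}}.$$ Moreover, if $\gamma\le 0$, then this $f$ is the only bounded solution of the problem. -/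

import Mathlib

open Set Filter Topology

/-- `f` is, on `[0, ∞)`, a solution of the boundary value problem
`f''' + (m + 2) f f'' - (2 m + 1) f' ^ 2 = 0`, `f 0 = -γ`, `f' (∞) = 0`, `f'' 0 = -1`.
All derivatives are taken within `[0, ∞)` (one-sided at `0`), so only the values of `f`
on `[0, ∞)` matter. -/
structure IsSolution (m γ : ℝ) (f : ℝ → ℝ) : Prop where
  contDiffOn : ContDiffOn ℝ 3 f (Ici 0)
  equation : ∀ t : ℝ, 0 ≤ t →
    iteratedDerivWithin 3 f (Ici 0) t + (m + 2) * f t * iteratedDerivWithin 2 f (Ici 0) t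
      - (2 * m + 1) * derivWithin f (Ici 0) t ^ 2 = 0
  value_zero : f 0 = -γ
  deriv_infty : Tendsto (fun t => derivWithin f (Ici 0) t) atTop (𝓝 0)
  second_deriv_zero : iteratedDerivWithin 2 f (Ici 0) 0 = -1

/-- `f` is a solution of the boundary value problem that is bounded on `[0, ∞)`. -/
def IsBoundedSolution (m γ : ℝ) (f : ℝ → ℝ) : Prop :=
  IsSolution m γ f ∧ ∃ C : ℝ, ∀ t : ℝ, 0 ≤ t → |f t| ≤ C

/-! Put a = m + 2 and b = -(2m + 1), so that 0 ≤ b < a, and write (f, v, w) = (f, f', f''). Two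
identities drive the proof: the flux w + a f v has derivative (a - b) v², and the energy v + (a/2)
f² has the flux as its derivative. As b ≥ 0, a negative w stays negative.

Existence is by shooting on the slope. The slopes for which v becomes negative, and those for which
v and the flux become positive together, form disjoint nonempty open sets, so some slope lies in
neither (`exists_trajectory`). Its trajectory has v ≥ 0 and nonpositive flux; the energy then
decreases, which makes the trajectory global and bounded. Energy decay is also the square root
bound.

For uniqueness with f(0) ≥ 0, the position x = f serves as independent variable. Slopes of two
trajectories with the same limit differ by a factor at most 2; `IsProfile.comparison_step` improves
a factor θ to √θ, so they coincide. Different limits are matched by the scaling κ f(κt); strict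
growth of the scale-invariant w / f³ then forces κ = 1 (`slope_eq_of_limit_le`). -/

/-! ### Autonomous ODEs: truncation, continuation, dependence on data -/

section Autonomous

variable {E : Type*} [NormedAddCommGroup E] [NormedSpace ℝ E]

/-- A `C¹` vector field agrees on any ball with a bounded, globally Lipschitz one. -/
lemma exists_lipschitzWith_bounded_eqOn_closedBall [FiniteDimensional ℝ E] {F : E → E} (hF : ContDiff ℝ 1 F) (R : ℝ) :
    ∃ (G : E → E) (K C : NNReal), LipschitzWith K G ∧ (∀ x, ‖G x‖ ≤ C) ∧
      ∀ x, ‖x‖ ≤ R → G x = F x := by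
  let χ : ContDiffBump (0 : E) :=
    ⟨max R 1, max R 1 + 1, lt_of_lt_of_le one_pos (le_max_right _ _), by linarith⟩
  have hG : ContDiff ℝ 1 (fun x => χ x • F x) := χ.contDiff.smul hF
  have hc : HasCompactSupport (fun x => χ x • F x) := χ.hasCompactSupport.smul_right
  obtain ⟨K, hK⟩ := hG.lipschitzWith_of_hasCompactSupport hc one_ne_zero
  obtain ⟨C, hC⟩ := hc.exists_bound_of_continuous hG.continuous
  refine ⟨_, K, C.toNNReal, hK, fun x => (hC x).trans (Real.le_coe_toNNReal C), fun x hx => ?_⟩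
  have : χ x = 1 := χ.one_of_mem_closedBall (by
    rw [mem_closedBall_zero_iff]; exact hx.trans (le_max_left _ _))
  simp [this]

lemma IsIntegralCurveOn.hasDerivWithinAt_Ici_of_Icc {x : ℝ → E} {F : ℝ → E → E} {T : ℝ}
    (hx : IsIntegralCurveOn x F (Icc 0 T)) {t : ℝ} (ht : t ∈ Ico 0 T) :
    HasDerivWithinAt x (F t (x t)) (Ici t) t := by
  have h1 : HasDerivWithinAt x (F t (x t)) (Icc t T) t :=
    (hx t ⟨ht.1, ht.2.le⟩).mono (Icc_subset_Icc_left ht.1)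
  exact h1.mono_of_mem_nhdsWithin (Icc_mem_nhdsGE ht.2)

lemma exists_isIntegralCurveOn_of_lipschitzWith [CompleteSpace E] {G : E → E} {K C : NNReal}
    (hG : LipschitzWith K G) (hC : ∀ x, ‖G x‖ ≤ C) (p : E) {T : ℝ} (hT : 0 ≤ T) :
    ∃ x : ℝ → E, x 0 = p ∧ IsIntegralCurveOn x (fun _ => G) (Icc 0 T) := by
  -- A curve of speed at most `C` travels at most `C * T`, so this radius gives existence on all of
  -- `[0, T]`.
  have hP : IsPicardLindelof (fun _ => G) (tmin := 0) (tmax := T) ⟨0, le_rfl, hT⟩ p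
      (C * T.toNNReal) 0 C K :=
    { lipschitzOnWith := fun _ _ => hG.lipschitzOnWith
      continuousOn := fun _ _ => continuousOn_const
      norm_le := fun _ _ x _ => hC x
      mul_max_le := by simp [hT] }
  obtain ⟨x, hx0, hx⟩ := hP.exists_eq_forall_mem_Icc_hasDerivWithinAt₀
  exact ⟨x, hx0, hx⟩

lemma IsIntegralCurveOn.congr_field {x : ℝ → E} {F G : E → E} {s : Set ℝ}
    (hx : IsIntegralCurveOn x (fun _ => F) s) (h : ∀ t ∈ s, F (x t) = G (x t)) :
    IsIntegralCurveOn x (fun _ => G) s := fun t ht => by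
  have := hx t ht
  beta_reduce at this ⊢
  rwa [h t ht] at this

lemma IsIntegralCurveOn.exists_norm_le {x : ℝ → E} {F : E → E} {T : ℝ}
    (hx : IsIntegralCurveOn x (fun _ => F) (Icc 0 T)) : ∃ R, ∀ t ∈ Icc 0 T, ‖x t‖ ≤ R :=
  isCompact_Icc.exists_bound_of_continuousOn hx.continuousOn

/-- Continuous dependence on initial data, including existence up to the same time. -/
lemma exists_isIntegralCurveOn_near [FiniteDimensional ℝ E] {F : E → E} (hF : ContDiff ℝ 1 F) {x : ℝ → E} {T : ℝ}
    (hT : 0 ≤ T) (hx : IsIntegralCurveOn x (fun _ => F) (Icc 0 T)) {ε : ℝ} (hε : 0 < ε) :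
    ∃ δ > 0, ∀ q, dist (x 0) q < δ → ∃ y : ℝ → E, y 0 = q ∧
      IsIntegralCurveOn y (fun _ => F) (Icc 0 T) ∧ dist (x T) (y T) < ε := by
  have := FiniteDimensional.complete ℝ E
  obtain ⟨R, hR⟩ := hx.exists_norm_le
  obtain ⟨G, K, C, hGK, hGC, hGF⟩ := exists_lipschitzWith_bounded_eqOn_closedBall hF (R + 1)
  have hxG : IsIntegralCurveOn x (fun _ => G) (Icc 0 T) :=
    hx.congr_field fun t ht => (hGF _ (by linarith [hR t ht])).symm
  have hη : 0 < min ε 1 := lt_min hε one_pos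
  -- Distance below 1 from `x` keeps the new curve in the ball of radius `R + 1`, where `G = F`; the
  -- exponential is the Grönwall factor.
  refine ⟨min ε 1 / Real.exp (K * T), by positivity, fun q hq => ?_⟩
  obtain ⟨y, hy0, hy⟩ := exists_isIntegralCurveOn_of_lipschitzWith hGK hGC q hT
  have hd : ∀ t ∈ Icc 0 T, dist (x t) (y t) < min ε 1 := by
    intro t ht
    have h1 := dist_le_of_trajectories_ODE (v := fun _ => G) (fun _ => hGK) hxG.continuousOn
      (fun _ ht => hxG.hasDerivWithinAt_Ici_of_Icc ht) hy.continuousOn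
      (fun _ ht => hy.hasDerivWithinAt_Ici_of_Icc ht) (le_refl (dist (x 0) (y 0))) t ht
    rw [hy0, sub_zero] at h1
    calc dist (x t) (y t) ≤ dist (x 0) q * Real.exp (K * t) := h1
      _ ≤ dist (x 0) q * Real.exp (K * T) := by
          have := ht.2
          gcongr
      _ < min ε 1 := by rwa [lt_div_iff₀ (Real.exp_pos _)] at hq
  refine ⟨y, hy0, hy.congr_field fun t ht => hGF _ ?_,
    (hd T ⟨hT, le_rfl⟩).trans_le (min_le_left _ _)⟩
  have h2 := (hd t ht).trans_le (min_le_right _ _)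
  have h3 := norm_le_norm_add_norm_sub' (y t) (x t)
  rw [← dist_eq_norm, dist_comm] at h3
  linarith [hR t ht]

lemma IsIntegralCurveOn.eqOn_Icc [FiniteDimensional ℝ E] {F : E → E} (hF : ContDiff ℝ 1 F) {x y : ℝ → E} {T : ℝ}
    (hx : IsIntegralCurveOn x (fun _ => F) (Icc 0 T))
    (hy : IsIntegralCurveOn y (fun _ => F) (Icc 0 T)) (h : x 0 = y 0) : EqOn x y (Icc 0 T) := by
  obtain ⟨R, hR⟩ := hx.exists_norm_le
  obtain ⟨R', hR'⟩ := hy.exists_norm_le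
  obtain ⟨G, K, C, hGK, hGC, hGF⟩ := exists_lipschitzWith_bounded_eqOn_closedBall hF (max R R')
  have hxG : IsIntegralCurveOn x (fun _ => G) (Icc 0 T) :=
    hx.congr_field fun t ht => (hGF _ ((hR t ht).trans (le_max_left _ _))).symm
  have hyG : IsIntegralCurveOn y (fun _ => G) (Icc 0 T) :=
    hy.congr_field fun t ht => (hGF _ ((hR' t ht).trans (le_max_right _ _))).symm
  exact ODE_solution_unique (v := fun _ => G) (fun _ => hGK) hxG.continuousOn
      (fun t ht => hxG.hasDerivWithinAt_Ici_of_Icc ht) hyG.continuousOn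
      (fun t ht => hyG.hasDerivWithinAt_Ici_of_Icc ht) h

lemma IsIntegralCurveOn.eqOn_Ici [FiniteDimensional ℝ E] {F : E → E} (hF : ContDiff ℝ 1 F) {x y : ℝ → E}
    (hx : IsIntegralCurveOn x (fun _ => F) (Ici 0))
    (hy : IsIntegralCurveOn y (fun _ => F) (Ici 0)) (h : x 0 = y 0) : EqOn x y (Ici 0) :=
  fun _ ht => IsIntegralCurveOn.eqOn_Icc hF (hx.mono Icc_subset_Ici_self)
    (hy.mono Icc_subset_Ici_self) h (right_mem_Icc.2 ht)

lemma isIntegralCurveOn_Icc_zero (F : E → E) (p : E) :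
    IsIntegralCurveOn (fun _ => p) (fun _ => F) (Icc (0 : ℝ) 0) := fun t _ => by
  rw [Icc_self]
  have h : HasFDerivWithinAt (fun _ : ℝ => p) (ContinuousLinearMap.toSpanSingleton ℝ (F p)) {0} t :=
    .of_subsingleton subsingleton_singleton
  simpa using h.hasDerivWithinAt

/-- If every integral curve from `p` obeys the same bound, then there are integral curves from `p`
on all intervals `[0, T]`. -/
lemma exists_isIntegralCurveOn_Icc_of_bound [FiniteDimensional ℝ E] {F : E → E} (hF : ContDiff ℝ 1 F) {p : E} {M : ℝ}
    (hM : ∀ (T : ℝ) (x : ℝ → E), 0 ≤ T → x 0 = p → IsIntegralCurveOn x (fun _ => F) (Icc 0 T) →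
      ‖x T‖ ≤ M) {T : ℝ} (hT : 0 ≤ T) :
    ∃ x : ℝ → E, x 0 = p ∧ IsIntegralCurveOn x (fun _ => F) (Icc 0 T) := by
  have := FiniteDimensional.complete ℝ E
  obtain ⟨G, K, C, hGK, hGC, hGF⟩ := exists_lipschitzWith_bounded_eqOn_closedBall hF (M + 1)
  obtain ⟨y, hy0, hy⟩ := exists_isIntegralCurveOn_of_lipschitzWith hGK hGC p hT
  suffices h : ∀ t ∈ Icc 0 T, ‖y t‖ ≤ M + 1 from
    ⟨y, hy0, hy.congr_field fun t ht => hGF _ (h t ht)⟩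
  by_contra! ⟨t, ht, hyt⟩
  have hp : ‖y 0‖ ≤ M := by
    have := hM 0 (fun _ => p) le_rfl rfl (isIntegralCurveOn_Icc_zero F p)
    rwa [hy0]
  have hcont : ContinuousOn (fun s => ‖y s‖) (Icc 0 T) := hy.continuousOn.norm
  have hne : (Icc 0 T ∩ (fun s => ‖y s‖) ⁻¹' Ici (M + 1)).Nonempty := ⟨t, ht, hyt.le⟩
  -- `s` is the first time the norm reaches `M + 1`. Up to `s` the truncated curve solves the
  -- original equation, so the a priori bound contradicts this.
  obtain ⟨s, ⟨hs, hsM⟩, hmin⟩ := (isCompact_Icc.of_isClosed_subset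
    (hcont.preimage_isClosed_of_isClosed isClosed_Icc isClosed_Ici)
    inter_subset_left).exists_isLeast hne
  have hsM : M + 1 ≤ ‖y s‖ := hsM
  have hsub : Icc 0 s ⊆ Icc 0 T := Icc_subset_Icc_right hs.2
  obtain ⟨r, hr, hry⟩ := intermediate_value_Icc hs.1 (hcont.mono hsub)
    (show M + 1 ∈ Icc ‖y 0‖ ‖y s‖ from ⟨by linarith, hsM⟩)
  have hry : ‖y r‖ = M + 1 := hry
  have hrs : r = s := le_antisymm hr.2 (hmin ⟨hsub hr, hry.ge⟩)
  have hyF : IsIntegralCurveOn y (fun _ => F) (Icc 0 s) := by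
    refine (hy.mono hsub).congr_field fun u hu => hGF _ ?_
    by_contra! hlt
    have : u = s := le_antisymm hu.2 (hmin ⟨hsub hu, hlt.le⟩)
    rw [this, ← hrs, hry] at hlt
    exact lt_irrefl _ hlt
  have := hM s y hs.1 hy0 hyF
  linarith

lemma exists_isIntegralCurveOn_Ici_of_bound [FiniteDimensional ℝ E] {F : E → E} (hF : ContDiff ℝ 1 F) {p : E} {M : ℝ}
    (hM : ∀ (T : ℝ) (x : ℝ → E), 0 ≤ T → x 0 = p → IsIntegralCurveOn x (fun _ => F) (Icc 0 T) →
      ‖x T‖ ≤ M) :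
    ∃ x : ℝ → E, x 0 = p ∧ IsIntegralCurveOn x (fun _ => F) (Ici 0) := by
  have h (n : ℕ) := exists_isIntegralCurveOn_Icc_of_bound hF hM (Nat.cast_nonneg (α := ℝ) n)
  choose z hz0 hz using h
  -- By uniqueness the curves on the intervals `[0, n]` agree, so they glue.
  have key : ∀ n : ℕ, ∀ t ∈ Icc (0 : ℝ) n, z ⌈t⌉₊ t = z n t := fun n t ht =>
    IsIntegralCurveOn.eqOn_Icc hF ((hz _).mono (Icc_subset_Icc_right (Nat.le_ceil t)))
      ((hz _).mono (Icc_subset_Icc_right ht.2)) (by rw [hz0, hz0]) (right_mem_Icc.2 ht.1)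
  refine ⟨fun t => z ⌈t⌉₊ t, hz0 _, fun t ht => ?_⟩
  have ht : 0 ≤ t := ht
  -- The extra 1 makes `[0, n]` a neighbourhood of `t` within `[0, ∞)` even when `t` is an integer.
  have htn : t < (⌈t⌉₊ + 1 : ℕ) := by
    push_cast
    linarith [Nat.le_ceil t]
  set n := ⌈t⌉₊ + 1
  have h1 : HasDerivWithinAt (fun t => z ⌈t⌉₊ t) (F (z n t)) (Icc 0 n) t :=
    (hz n t ⟨ht, htn.le⟩).congr (key n) (key n t ⟨ht, htn.le⟩)
  have h2 : F (z n t) = F ((fun t => z ⌈t⌉₊ t) t) := by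
    beta_reduce
    rw [key n t ⟨ht, htn.le⟩]
  rw [h2] at h1
  refine h1.mono_of_mem_nhdsWithin ?_
  have : Iic (n : ℝ) ∈ 𝓝 t := Iic_mem_nhds htn
  filter_upwards [mem_nhdsWithin_of_mem_nhds this, self_mem_nhdsWithin] with s h1 h2 using ⟨h2, h1⟩

/-- The initial data whose integral curve reaches a given open set form an open set. -/
lemma isOpen_setOf_exists_isIntegralCurveOn [FiniteDimensional ℝ E] {F : E → E} (hF : ContDiff ℝ 1 F) {U : Set E}
    (hU : IsOpen U) :
    IsOpen {p | ∃ (T : ℝ) (x : ℝ → E), 0 ≤ T ∧ x 0 = p ∧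
      IsIntegralCurveOn x (fun _ => F) (Icc 0 T) ∧ x T ∈ U} := by
  rw [Metric.isOpen_iff]
  rintro p ⟨T, x, hT, rfl, hx, hxU⟩
  obtain ⟨ε, hε, hball⟩ := Metric.isOpen_iff.1 hU _ hxU
  obtain ⟨δ, hδ, h⟩ := exists_isIntegralCurveOn_near hF hT hx hε
  refine ⟨δ, hδ, fun q hq => ?_⟩
  obtain ⟨y, hy0, hy, hd⟩ := h q (by rw [dist_comm]; exact hq)
  exact ⟨T, y, hT, hy0, hy, hball (by rw [Metric.mem_ball, dist_comm]; exact hd)⟩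

end Autonomous

/-! ### Monotonicity from one-sided derivatives -/

lemma antitoneOn_of_hasDerivWithinAt {s : Set ℝ} (hs : Convex ℝ s) {f f' : ℝ → ℝ}
    (hf : ∀ t ∈ s, HasDerivWithinAt f (f' t) s t) (h0 : ∀ t ∈ s, f' t ≤ 0) : AntitoneOn f s :=
  antitoneOn_of_hasDerivWithinAt_nonpos hs (fun t ht => (hf t ht).continuousWithinAt)
    (fun t ht => (hf t (interior_subset ht)).mono interior_subset)
    (fun t ht => h0 t (interior_subset ht))

lemma monotoneOn_of_hasDerivWithinAt {s : Set ℝ} (hs : Convex ℝ s) {f f' : ℝ → ℝ}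
    (hf : ∀ t ∈ s, HasDerivWithinAt f (f' t) s t) (h0 : ∀ t ∈ s, 0 ≤ f' t) : MonotoneOn f s :=
  monotoneOn_of_hasDerivWithinAt_nonneg hs (fun t ht => (hf t ht).continuousWithinAt)
    (fun t ht => (hf t (interior_subset ht)).mono interior_subset)
    (fun t ht => h0 t (interior_subset ht))

lemma strictAntiOn_of_hasDerivWithinAt {s : Set ℝ} (hs : Convex ℝ s) {f f' : ℝ → ℝ}
    (hf : ∀ t ∈ s, HasDerivWithinAt f (f' t) s t) (h0 : ∀ t ∈ s, f' t < 0) : StrictAntiOn f s :=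
  strictAntiOn_of_hasDerivWithinAt_neg hs (fun t ht => (hf t ht).continuousWithinAt)
    (fun t ht => (hf t (interior_subset ht)).mono interior_subset)
    (fun t ht => h0 t (interior_subset ht))

lemma strictMonoOn_of_hasDerivWithinAt {s : Set ℝ} (hs : Convex ℝ s) {f f' : ℝ → ℝ}
    (hf : ∀ t ∈ s, HasDerivWithinAt f (f' t) s t) (h0 : ∀ t ∈ s, 0 < f' t) : StrictMonoOn f s :=
  strictMonoOn_of_hasDerivWithinAt_pos hs (fun t ht => (hf t ht).continuousWithinAt)
    (fun t ht => (hf t (interior_subset ht)).mono interior_subset)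
    (fun t ht => h0 t (interior_subset ht))

/-! ### The first order system: flux, energy, scaling -/

/-- The triple `(f, v, w) = (f, f', f'')` solves `f''' + a f f'' + b f' ^ 2 = 0` on `s`. -/
structure IsTrajectory (a b : ℝ) (s : Set ℝ) (f v w : ℝ → ℝ) : Prop where
  deriv_f : ∀ t ∈ s, HasDerivWithinAt f (v t) s t
  deriv_v : ∀ t ∈ s, HasDerivWithinAt v (w t) s t
  deriv_w : ∀ t ∈ s, HasDerivWithinAt w (-a * f t * w t - b * v t ^ 2) s t

/-- The vector field of the first order system. -/
def flowField (a b : ℝ) (x : ℝ × ℝ × ℝ) : ℝ × ℝ × ℝ :=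
  (x.2.1, x.2.2, -a * x.1 * x.2.2 - b * x.2.1 ^ 2)

lemma contDiff_flowField (a b : ℝ) : ContDiff ℝ 1 (flowField a b) := by
  unfold flowField
  fun_prop

namespace IsTrajectory

variable {a b : ℝ} {s : Set ℝ} {f v w : ℝ → ℝ}

lemma mono (h : IsTrajectory a b s f v w) {u : Set ℝ} (hu : u ⊆ s) : IsTrajectory a b u f v w :=
  ⟨fun t ht => (h.deriv_f t (hu ht)).mono hu, fun t ht => (h.deriv_v t (hu ht)).mono hu,
    fun t ht => (h.deriv_w t (hu ht)).mono hu⟩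

lemma isIntegralCurveOn (h : IsTrajectory a b s f v w) :
    IsIntegralCurveOn (fun t => (f t, v t, w t)) (fun _ => flowField a b) s := fun t ht =>
  (h.deriv_f t ht).prodMk ((h.deriv_v t ht).prodMk (h.deriv_w t ht))

lemma of_isIntegralCurveOn {x : ℝ → ℝ × ℝ × ℝ}
    (h : IsIntegralCurveOn x (fun _ => flowField a b) s) :
    IsTrajectory a b s (fun t => (x t).1) (fun t => (x t).2.1) (fun t => (x t).2.2) := by
  have h1 : ∀ t ∈ s, HasDerivWithinAt x (flowField a b (x t)) s t := h
  exact ⟨fun t ht => (h1 t ht).fst, fun t ht => (h1 t ht).snd.fst, fun t ht => (h1 t ht).snd.snd⟩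

lemma continuousOn_f (h : IsTrajectory a b s f v w) : ContinuousOn f s :=
  fun t ht => (h.deriv_f t ht).continuousWithinAt

lemma continuousOn_v (h : IsTrajectory a b s f v w) : ContinuousOn v s :=
  fun t ht => (h.deriv_v t ht).continuousWithinAt

lemma continuousOn_w (h : IsTrajectory a b s f v w) : ContinuousOn w s :=
  fun t ht => (h.deriv_w t ht).continuousWithinAt

lemma hasDerivWithinAt_flux (h : IsTrajectory a b s f v w) {t : ℝ} (ht : t ∈ s) :
    HasDerivWithinAt (fun t => w t + a * f t * v t) ((a - b) * v t ^ 2) s t :=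
  ((h.deriv_w t ht).add (((h.deriv_f t ht).const_mul a).mul (h.deriv_v t ht))).congr_deriv
    (by ring)

lemma hasDerivWithinAt_energy (h : IsTrajectory a b s f v w) {t : ℝ} (ht : t ∈ s) :
    HasDerivWithinAt (fun t => v t + a / 2 * f t ^ 2) (w t + a * f t * v t) s t :=
  ((h.deriv_v t ht).add (((h.deriv_f t ht).pow 2).const_mul (a / 2))).congr_deriv
    (by push_cast; ring)

lemma monotoneOn_flux (h : IsTrajectory a b s f v w) (hs : Convex ℝ s) (hab : b ≤ a) :
    MonotoneOn (fun t => w t + a * f t * v t) s :=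
  monotoneOn_of_hasDerivWithinAt hs (fun _ ht => h.hasDerivWithinAt_flux ht)
    fun _ _ => mul_nonneg (sub_nonneg.2 hab) (sq_nonneg _)

/-- If `b ≥ 0`, concavity propagates from the initial point. -/
lemma w_neg {T : ℝ} (h : IsTrajectory a b (Icc 0 T) f v w) (hb : 0 ≤ b) (h0 : w 0 < 0) {t : ℝ}
    (ht : t ∈ Icc 0 T) : w t < 0 := by
  have hT : 0 ≤ T := ht.1.trans ht.2
  -- The integrating factor `exp (a * Φ)` with `Φ' = f` removes the term `a f w`. Extending `f`
  -- continuously to ℝ provides the antiderivative `Φ`.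
  set φ : ℝ → ℝ := IccExtend hT ((Icc 0 T).domRestrict f)
  have hφ : Continuous φ := h.continuousOn_f.domRestrict.Icc_extend'
  have hφf : ∀ u ∈ Icc 0 T, φ u = f u := fun u hu => IccExtend_of_mem hT _ hu
  set Φ : ℝ → ℝ := fun u => ∫ r in (0 : ℝ)..u, φ r
  have hΦ : ∀ u ∈ Icc 0 T, HasDerivWithinAt Φ (f u) (Icc 0 T) u := fun u hu => by
    rw [← hφf u hu]
    exact (hφ.integral_hasStrictDerivAt 0 u).hasDerivAt.hasDerivWithinAt
  have hanti : AntitoneOn (fun u => w u * Real.exp (a * Φ u)) (Icc 0 T) := by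
    refine antitoneOn_of_hasDerivWithinAt (convex_Icc 0 T)
      (f' := fun u => -(b * v u ^ 2 * Real.exp (a * Φ u))) (fun u hu => ?_) fun u _ => ?_
    · exact ((h.deriv_w u hu).mul (((hΦ u hu).const_mul a).exp)).congr_deriv (by ring)
    · exact neg_nonpos.2 (by positivity)
  have h1 := hanti ⟨le_rfl, hT⟩ ht ht.1
  simp only [Φ, intervalIntegral.integral_same, mul_zero, Real.exp_zero, mul_one] at h1
  exact neg_of_mul_neg_left (h1.trans_lt h0) (Real.exp_pos _).le

lemma w_neg_Ici (h : IsTrajectory a b (Ici 0) f v w) (hb : 0 ≤ b) (h0 : w 0 < 0) {t : ℝ}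
    (ht : 0 ≤ t) : w t < 0 :=
  (h.mono Icc_subset_Ici_self).w_neg hb h0 (right_mem_Icc.2 ht)

lemma strictAntiOn_v {T : ℝ} (h : IsTrajectory a b (Icc 0 T) f v w) (hb : 0 ≤ b) (h0 : w 0 < 0) :
    StrictAntiOn v (Icc 0 T) :=
  strictAntiOn_of_hasDerivWithinAt (convex_Icc 0 T) h.deriv_v fun _ ht => h.w_neg hb h0 ht

lemma strictAntiOn_v_Ici (h : IsTrajectory a b (Ici 0) f v w) (hb : 0 ≤ b) (h0 : w 0 < 0) :
    StrictAntiOn v (Ici 0) :=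
  strictAntiOn_of_hasDerivWithinAt (convex_Ici 0) h.deriv_v fun _ ht => h.w_neg_Ici hb h0 ht

/-- A concave trajectory cannot have both a negative slope somewhere and, elsewhere, a positive slope
together with a positive flux. -/
lemma not_flux_pos {T : ℝ} (h : IsTrajectory a b (Icc 0 T) f v w) (hb : 0 ≤ b) (hab : b ≤ a)
    (h0 : w 0 < 0) {r t : ℝ} (hr : r ∈ Icc 0 T) (ht : t ∈ Icc 0 T) (hvr : v r < 0)
    (hvt : 0 < v t) : w t + a * f t * v t ≤ 0 := by
  have htr : t ≤ r := by
    by_contra! hlt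
    have := h.strictAntiOn_v hb h0 hr ht hlt
    linarith
  have hsub : Icc t r ⊆ Icc 0 T := Icc_subset_Icc ht.1 hr.2
  -- At a zero of the slope the flux equals `w < 0`, and the flux is nondecreasing.
  obtain ⟨c, hc, hvc⟩ := intermediate_value_Icc' htr (h.continuousOn_v.mono hsub)
    (show (0 : ℝ) ∈ Icc (v r) (v t) from ⟨hvr.le, hvt.le⟩)
  have h1 := h.monotoneOn_flux (convex_Icc 0 T) hab ht (hsub hc) hc.1
  have h2 := h.w_neg hb h0 (hsub hc)
  simp only [hvc, mul_zero, add_zero] at h1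
  linarith

/-- Rescaled trajectories are trajectories. -/
lemma rescale (h : IsTrajectory a b (Ici 0) f v w) {κ : ℝ} (hκ : 0 < κ) :
    IsTrajectory a b (Ici 0) (fun t => κ * f (κ * t)) (fun t => κ ^ 2 * v (κ * t))
      (fun t => κ ^ 3 * w (κ * t)) := by
  have hm : MapsTo (fun t => κ * t) (Ici 0) (Ici 0) := fun t ht => mul_nonneg hκ.le ht
  have hd : ∀ t, HasDerivWithinAt (fun t => κ * t) κ (Ici 0) t := fun t => by
    simpa using ((hasDerivAt_id t).const_mul κ).hasDerivWithinAt
  refine ⟨fun t ht => ?_, fun t ht => ?_, fun t ht => ?_⟩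
  · exact (((h.deriv_f _ (hm ht)).comp t (hd t) hm).const_mul κ).congr_deriv (by ring)
  · exact (((h.deriv_v _ (hm ht)).comp t (hd t) hm).const_mul (κ ^ 2)).congr_deriv (by ring)
  · exact (((h.deriv_w _ (hm ht)).comp t (hd t) hm).const_mul (κ ^ 3)).congr_deriv (by ring)

/-- Shifted trajectories are trajectories. -/
lemma shift (h : IsTrajectory a b (Ici 0) f v w) {c : ℝ} (hc : 0 ≤ c) :
    IsTrajectory a b (Ici 0) (fun t => f (c + t)) (fun t => v (c + t)) (fun t => w (c + t)) := by
  have hm : MapsTo (fun t => c + t) (Ici 0) (Ici 0) := fun t ht => add_nonneg hc ht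
  have hd : ∀ t, HasDerivWithinAt (fun t => c + t) 1 (Ici 0) t := fun t =>
    ((hasDerivAt_id t).const_add c).hasDerivWithinAt
  refine ⟨fun t ht => ?_, fun t ht => ?_, fun t ht => ?_⟩
  · exact ((h.deriv_f _ (hm ht)).comp t (hd t) hm).congr_deriv (by ring)
  · exact ((h.deriv_v _ (hm ht)).comp t (hd t) hm).congr_deriv (by ring)
  · exact ((h.deriv_w _ (hm ht)).comp t (hd t) hm).congr_deriv (by ring)

end IsTrajectory

/-! ### Shooting -/

/-- The initial data from which the slope becomes negative. -/
def descendingData (a b : ℝ) : Set (ℝ × ℝ × ℝ) :=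
  {p | ∃ (T : ℝ) (x : ℝ → ℝ × ℝ × ℝ), 0 ≤ T ∧ x 0 = p ∧
    IsIntegralCurveOn x (fun _ => flowField a b) (Icc 0 T) ∧ x T ∈ {y | y.2.1 < 0}}

/-- The initial data from which slope and flux become positive simultaneously. -/
def escapingData (a b : ℝ) : Set (ℝ × ℝ × ℝ) :=
  {p | ∃ (T : ℝ) (x : ℝ → ℝ × ℝ × ℝ), 0 ≤ T ∧ x 0 = p ∧
    IsIntegralCurveOn x (fun _ => flowField a b) (Icc 0 T) ∧
    x T ∈ {y | 0 < y.2.1 ∧ 0 < y.2.2 + a * y.1 * y.2.1}}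

section Shooting

variable {a b : ℝ}

lemma isOpen_descendingData : IsOpen (descendingData a b) :=
  isOpen_setOf_exists_isIntegralCurveOn (contDiff_flowField a b)
    (isOpen_lt (by fun_prop) continuous_const)

lemma isOpen_escapingData : IsOpen (escapingData a b) :=
  isOpen_setOf_exists_isIntegralCurveOn (contDiff_flowField a b)
    ((isOpen_lt (f := fun _ : ℝ × ℝ × ℝ => (0 : ℝ)) (g := fun y => y.2.1)
      (by fun_prop) (by fun_prop)).inter
      (isOpen_lt (f := fun _ : ℝ × ℝ × ℝ => (0 : ℝ)) (g := fun y => y.2.2 + a * y.1 * y.2.1)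
        (by fun_prop) (by fun_prop)))

/-- Uniqueness identifies the two curves on the shorter interval, so both events would occur on the
longer one, against `not_flux_pos`. -/
lemma not_mem_escapingData (hb : 0 ≤ b) (hab : b ≤ a) {p : ℝ × ℝ × ℝ} (hp : p.2.2 < 0)
    (hA : p ∈ descendingData a b) : p ∉ escapingData a b := by
  rintro ⟨S, y, hS, hy0, hy, hyv, hyQ⟩
  obtain ⟨T, x, hT, hx0, hx, hxv⟩ := hA
  have hxv : (x T).2.1 < 0 := hxv
  rcases le_total S T with h | h
  · have heq : x S = y S := IsIntegralCurveOn.eqOn_Icc (contDiff_flowField a b)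
      (hx.mono (Icc_subset_Icc_right h)) hy (hx0.trans hy0.symm) ⟨hS, le_rfl⟩
    rw [← heq] at hyv hyQ
    have := (IsTrajectory.of_isIntegralCurveOn hx).not_flux_pos hb hab (by rwa [hx0])
      (r := T) (t := S) ⟨hT, le_rfl⟩ ⟨hS, h⟩ hxv hyv
    linarith
  · have heq : x T = y T := IsIntegralCurveOn.eqOn_Icc (contDiff_flowField a b)
      hx (hy.mono (Icc_subset_Icc_right h)) (hx0.trans hy0.symm) ⟨hT, le_rfl⟩
    rw [heq] at hxv
    have := (IsTrajectory.of_isIntegralCurveOn hy).not_flux_pos hb hab (by rwa [hy0])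
      (r := T) (t := S) ⟨hT, h⟩ ⟨hS, le_rfl⟩ hxv hyv
    linarith

lemma mem_descendingData_of_neg {p : ℝ × ℝ × ℝ} (hp : p.2.1 < 0) : p ∈ descendingData a b :=
  ⟨0, fun _ => p, le_rfl, rfl, isIntegralCurveOn_Icc_zero _ _, hp⟩

/-- The flux starts at 0 with derivative `a - b > 0`, so it is positive at once while the slope is
still near 1. -/
lemma zero_one_zero_mem_escapingData (hab : b < a) :
    ((0, 1, 0) : ℝ × ℝ × ℝ) ∈ escapingData a b := by
  obtain ⟨G, K, C, hGK, hGC, hGF⟩ :=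
    exists_lipschitzWith_bounded_eqOn_closedBall (contDiff_flowField a b) 2
  obtain ⟨y, hy0, hy⟩ :=
    exists_isIntegralCurveOn_of_lipschitzWith hGK hGC (0, 1, 0) zero_le_one
  have h0 : (0 : ℝ) ∈ Icc (0 : ℝ) 1 := ⟨le_rfl, zero_le_one⟩
  have hc : ContinuousWithinAt y (Icc 0 1) 0 := hy.continuousOn 0 h0
  have hn : ‖y 0‖ < 2 := by
    rw [hy0]
    simp [Prod.norm_def]
  have hv : 0 < (y 0).2.1 := by simp [hy0]
  have e1 : ∀ᶠ t in 𝓝[Icc 0 1] (0 : ℝ), ‖y t‖ < 2 := hc.norm.eventually_lt_const hn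
  have e2 : ∀ᶠ t in 𝓝[Icc 0 1] (0 : ℝ), 0 < (y t).2.1 :=
    Filter.Tendsto.eventually_const_lt hv hc.snd.fst
  obtain ⟨δ, hδ, hδs⟩ := Metric.mem_nhdsWithin_iff.1 (e1.and e2)
  set T := min (δ / 2) 1
  have hT : 0 < T := lt_min (by linarith) one_pos
  have hTI : Icc 0 T ⊆ Icc 0 1 := Icc_subset_Icc_right (min_le_right _ _)
  have hs : ∀ t ∈ Icc 0 T, ‖y t‖ < 2 ∧ 0 < (y t).2.1 := fun t ht => hδs
    ⟨by
      rw [Metric.mem_ball, Real.dist_eq, sub_zero, abs_of_nonneg ht.1]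
      linarith [ht.2, min_le_left (δ / 2) 1], hTI ht⟩
  have hyF : IsIntegralCurveOn y (fun _ => flowField a b) (Icc 0 T) :=
    (hy.mono hTI).congr_field fun t ht => hGF _ (hs t ht).1.le
  have htr := IsTrajectory.of_isIntegralCurveOn hyF
  have hmono := strictMonoOn_of_hasDerivWithinAt (convex_Icc 0 T)
    (fun t ht => htr.hasDerivWithinAt_flux ht)
    (fun t ht => mul_pos (sub_pos.2 hab) (pow_pos (hs t ht).2 2))
  have hlt := hmono ⟨le_rfl, hT.le⟩ ⟨hT.le, le_rfl⟩ hT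
  simp only [hy0, mul_zero, zero_mul, add_zero] at hlt
  exact ⟨T, y, hT.le, hy0, hyF, (hs T ⟨hT.le, le_rfl⟩).2, hlt⟩

/-- From initial data that are neither descending nor escaping starts a global trajectory. -/
lemma exists_trajectory_of_notMem (ha : 0 < a) (hb : 0 ≤ b) (hab : b ≤ a) {p : ℝ × ℝ × ℝ}
    (hp : p.2.2 < 0) (hA : p ∉ descendingData a b) (hB : p ∉ escapingData a b) :
    ∃ f v w : ℝ → ℝ, IsTrajectory a b (Ici 0) f v w ∧ f 0 = p.1 ∧ w 0 = p.2.2 ∧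
      (∀ t, 0 ≤ t → 0 ≤ v t) ∧ ∀ t, 0 ≤ t → w t + a * f t * v t ≤ 0 := by
  have key : ∀ (T : ℝ) (x : ℝ → ℝ × ℝ × ℝ), 0 ≤ T → x 0 = p →
      IsIntegralCurveOn x (fun _ => flowField a b) (Icc 0 T) → 0 ≤ (x T).2.1 ∧ (x T).2.2 < 0 ∧
        (x T).2.2 + a * (x T).1 * (x T).2.1 ≤ 0 := by
    intro T x hT hx0 hx
    have hv : 0 ≤ (x T).2.1 := by
      by_contra! h
      exact hA ⟨T, x, hT, hx0, hx, h⟩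
    have hw : (x T).2.2 < 0 := (IsTrajectory.of_isIntegralCurveOn hx).w_neg hb (by rwa [hx0])
      ⟨hT, le_rfl⟩
    refine ⟨hv, hw, ?_⟩
    rcases hv.eq_or_lt with h | h
    · rw [← h, mul_zero, add_zero]
      exact hw.le
    · by_contra! h'
      exact hB ⟨T, x, hT, hx0, hx, h, h'⟩
  set E₀ := p.2.1 + a / 2 * p.1 ^ 2
  set q₀ := p.2.2 + a * p.1 * p.2.1
  -- Energy decay gives `v ≤ E₀` and `f ^ 2 ≤ 2 * E₀ / a`, whence `|f| ≤ 1 + f ^ 2` is bounded; the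
  -- nondecreasing flux bounds `w` below.
  have hbound : ∀ (T : ℝ) (x : ℝ → ℝ × ℝ × ℝ), 0 ≤ T → x 0 = p →
      IsIntegralCurveOn x (fun _ => flowField a b) (Icc 0 T) →
      ‖x T‖ ≤ (1 + 2 * E₀ / a) + E₀ + (a * (1 + 2 * E₀ / a) * E₀ + |q₀|) := by
    intro T x hT hx0 hx
    have htr := IsTrajectory.of_isIntegralCurveOn hx
    obtain ⟨hv, hw, hQ⟩ := key T x hT hx0 hx
    have hT' : T ∈ Icc 0 T := ⟨hT, le_rfl⟩
    have h0 : 0 ∈ Icc 0 T := ⟨le_rfl, hT⟩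
    have hE := antitoneOn_of_hasDerivWithinAt (convex_Icc 0 T)
      (fun t ht => htr.hasDerivWithinAt_energy ht)
      (fun t ht => (key t x ht.1 hx0 (hx.mono (Icc_subset_Icc_right ht.2))).2.2) h0 hT' hT
    have hF := htr.monotoneOn_flux (convex_Icc 0 T) hab h0 hT' hT
    simp only [hx0] at hE hF
    have hE : (x T).2.1 + a / 2 * (x T).1 ^ 2 ≤ E₀ := hE
    have hF : q₀ ≤ (x T).2.2 + a * (x T).1 * (x T).2.1 := hF
    have hf2 : 0 ≤ a / 2 * (x T).1 ^ 2 := by positivity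
    have hE0 : 0 ≤ E₀ := by linarith
    have hvE : (x T).2.1 ≤ E₀ := by linarith
    have hsq : (x T).1 ^ 2 ≤ 2 * E₀ / a := by
      rw [le_div_iff₀ ha]
      nlinarith
    have hfM : |(x T).1| ≤ 1 + 2 * E₀ / a := by
      have := sq_abs (x T).1
      nlinarith [sq_nonneg (|(x T).1| - 1), abs_nonneg (x T).1]
    have hD : 0 ≤ 2 * E₀ / a := by positivity
    have hfv : a * (x T).1 * (x T).2.1 ≤ a * (1 + 2 * E₀ / a) * E₀ := by
      have := (le_abs_self _).trans hfM
      gcongr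
    have hP : 0 ≤ a * (1 + 2 * E₀ / a) * E₀ := by positivity
    have hwM : |(x T).2.2| ≤ a * (1 + 2 * E₀ / a) * E₀ + |q₀| := by
      rw [abs_of_neg hw]
      linarith [neg_abs_le q₀]
    have hvM : |(x T).2.1| ≤ E₀ := by rwa [abs_of_nonneg hv]
    simp only [Prod.norm_def, Real.norm_eq_abs]
    have := abs_nonneg q₀
    refine max_le (by linarith) (max_le (by linarith) (by linarith))
  obtain ⟨x, hx0, hx⟩ := exists_isIntegralCurveOn_Ici_of_bound (contDiff_flowField a b) hbound
  have hk := fun (t : ℝ) (ht : 0 ≤ t) => key t x ht hx0 (hx.mono Icc_subset_Ici_self)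
  exact ⟨_, _, _, IsTrajectory.of_isIntegralCurveOn hx, by rw [hx0], by rw [hx0],
    fun t ht => (hk t ht).1, fun t ht => (hk t ht).2.2⟩

/-- The shooting argument. -/
lemma exists_trajectory (ha : 0 < a) (hb : 0 ≤ b) (hab : b < a) (x₀ : ℝ) :
    ∃ f v w : ℝ → ℝ, IsTrajectory a b (Ici 0) f v w ∧ f 0 = x₀ ∧ w 0 = -1 ∧
      (∀ t, 0 ≤ t → 0 ≤ v t) ∧ ∀ t, 0 ≤ t → w t + a * f t * v t ≤ 0 := by
  -- These are the data `(x₀, ε⁻², -1)` scaled by `ε`; as `ε → 0` they approach an escaping point.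
  -- Scaling back by `ε⁻¹` restores the prescribed values.
  have hpath : Continuous (fun ε : ℝ => ((x₀ * ε, 1, -ε ^ 3) : ℝ × ℝ × ℝ)) := by fun_prop
  have hnear : ∀ᶠ ε in 𝓝 (0 : ℝ), ((x₀ * ε, 1, -ε ^ 3) : ℝ × ℝ × ℝ) ∈ escapingData a b :=
    hpath.continuousAt.eventually_mem (isOpen_escapingData.mem_nhds
      (by simpa using zero_one_zero_mem_escapingData hab))
  obtain ⟨ε, hεB, hε⟩ := ((hnear.filter_mono nhdsWithin_le_nhds).and
    (self_mem_nhdsWithin : Ioi (0 : ℝ) ∈ 𝓝[>] 0)).exists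
  have hε : 0 < ε := hε
  have hline : Continuous (fun c : ℝ => ((x₀ * ε, c, -ε ^ 3) : ℝ × ℝ × ℝ)) := by fun_prop
  have hε3 : -ε ^ 3 < 0 := neg_lt_zero.2 (pow_pos hε 3)
  obtain ⟨c, hcA, hcB⟩ : ∃ c : ℝ, ((x₀ * ε, c, -ε ^ 3) : ℝ × ℝ × ℝ) ∉ descendingData a b ∧
      ((x₀ * ε, c, -ε ^ 3) : ℝ × ℝ × ℝ) ∉ escapingData a b := by
    by_contra! hall
    obtain ⟨c, -, hc1, hc2⟩ := isPreconnected_univ _ _ (isOpen_descendingData.preimage hline)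
      (isOpen_escapingData.preimage hline)
      (fun c _ => (em _).imp_right (hall c))
      ⟨-1, trivial, mem_descendingData_of_neg (by simp)⟩ ⟨1, trivial, hεB⟩
    exact not_mem_escapingData hb hab.le hε3 hc1 hc2
  obtain ⟨f, v, w, htr, hf0, hw0, hv, hQ⟩ := exists_trajectory_of_notMem ha hb hab.le hε3 hcA hcB
  have hκ : 0 < ε⁻¹ := inv_pos.2 hε
  refine ⟨_, _, _, htr.rescale hκ, ?_, ?_, fun t ht => ?_, fun t ht => ?_⟩
  · rw [mul_zero, hf0]
    field_simp
  · rw [mul_zero, hw0]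
    field_simp
  · have := hv (ε⁻¹ * t) (by positivity)
    positivity
  · have := mul_nonpos_of_nonneg_of_nonpos (pow_nonneg hκ.le 3) (hQ (ε⁻¹ * t) (by positivity))
    linarith

end Shooting

/-! ### Bounded trajectories and their behaviour at infinity -/

lemma MonotoneOn.exists_tendsto_atTop_of_le {f : ℝ → ℝ} (hf : MonotoneOn f (Ici 0)) {C : ℝ}
    (hC : ∀ t, 0 ≤ t → f t ≤ C) : ∃ L, Tendsto f atTop (𝓝 L) := by
  have hm : Monotone (fun t => f (max 0 t)) := fun s t hst =>
    hf (le_max_left 0 s) (le_max_left 0 t) (max_le_max le_rfl hst)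
  have hb : BddAbove (range fun t => f (max 0 t)) :=
    ⟨C, by rintro _ ⟨t, rfl⟩; exact hC _ (le_max_left _ _)⟩
  refine ⟨_, (tendsto_atTop_ciSup hm hb).congr' ?_⟩
  filter_upwards [eventually_ge_atTop 0] with t ht
  rw [max_eq_right ht]

lemma MonotoneOn.le_of_tendsto_atTop {f : ℝ → ℝ} (hf : MonotoneOn f (Ici 0)) {L : ℝ}
    (hL : Tendsto f atTop (𝓝 L)) {t : ℝ} (ht : 0 ≤ t) : f t ≤ L :=
  ge_of_tendsto hL (by
    filter_upwards [eventually_ge_atTop t] with s hs using hf ht (ht.trans hs) hs)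

lemma AntitoneOn.ge_of_tendsto_atTop {f : ℝ → ℝ} (hf : AntitoneOn f (Ici 0)) {L : ℝ}
    (hL : Tendsto f atTop (𝓝 L)) {t : ℝ} (ht : 0 ≤ t) : L ≤ f t :=
  le_of_tendsto hL (by
    filter_upwards [eventually_ge_atTop t] with s hs using hf ht (ht.trans hs) hs)

/-- A trajectory on `[0, ∞)` that starts concave, stays bounded and flattens at infinity. -/
structure IsBoundedTrajectory (a b : ℝ) (f v w : ℝ → ℝ) : Prop
    extends IsTrajectory a b (Ici 0) f v w where
  w_zero_neg : w 0 < 0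
  bounded : ∃ C, ∀ t, 0 ≤ t → |f t| ≤ C
  tendsto_v : Tendsto v atTop (𝓝 0)

namespace IsTrajectory

variable {a b : ℝ} {f v w : ℝ → ℝ}

/-- A global concave trajectory with nonnegative slope and nonpositive flux is bounded. -/
lemma isBoundedTrajectory (h : IsTrajectory a b (Ici 0) f v w) (ha : 0 < a) (hb : 0 ≤ b)
    (h0 : w 0 < 0) (hv : ∀ t, 0 ≤ t → 0 ≤ v t) (hQ : ∀ t, 0 ≤ t → w t + a * f t * v t ≤ 0) :
    IsBoundedTrajectory a b f v w := by
  have hE := antitoneOn_of_hasDerivWithinAt (convex_Ici 0)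
    (fun t ht => h.hasDerivWithinAt_energy ht) hQ
  set E₀ := v 0 + a / 2 * f 0 ^ 2
  have hf : ∀ t, 0 ≤ t → |f t| ≤ 1 + 2 * E₀ / a := fun t ht => by
    have h1 : v t + a / 2 * f t ^ 2 ≤ E₀ := hE self_mem_Ici ht ht
    have h2 := hv t ht
    have hsq : f t ^ 2 ≤ 2 * E₀ / a := by
      rw [le_div_iff₀ ha]
      nlinarith
    nlinarith [sq_nonneg (|f t| - 1), abs_nonneg (f t), sq_abs (f t)]
  refine ⟨h, h0, ⟨_, hf⟩, ?_⟩
  have hanti := (h.strictAntiOn_v_Ici hb h0).antitoneOn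
  obtain ⟨l, hl⟩ := hanti.neg.exists_tendsto_atTop_of_le (C := 0)
    fun t ht => neg_nonpos.2 (hv t ht)
  have hl : Tendsto v atTop (𝓝 (-l)) := by simpa using hl.neg
  have hle : ∀ t, 0 ≤ t → -l ≤ v t := fun t ht => hanti.ge_of_tendsto_atTop hl ht
  have hl0 : 0 ≤ -l := ge_of_tendsto hl (by
    filter_upwards [eventually_ge_atTop 0] with t ht using hv t ht)
  rcases hl0.eq_or_lt with h1 | h1
  · rwa [← h1] at hl
  exfalso
  have hmono := monotoneOn_of_hasDerivWithinAt (convex_Ici 0)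
    (fun t ht => (h.deriv_f t ht).sub
      (((hasDerivAt_id t).const_mul (-l)).hasDerivWithinAt (s := Ici 0)))
    (fun t ht => by simpa using neg_le_iff_add_nonneg.1 (hle t ht))
  set D := 1 + 2 * E₀ / a
  have hD : 0 ≤ D := (abs_nonneg _).trans (hf 0 le_rfl)
  -- Here `-l` is the limit of `v`, so by this time `f` has gained at least `2 * D + 1`, although
  -- `|f| ≤ D`.
  have ht : 0 ≤ (2 * D + 1) / (-l) := by positivity
  have h2 := hmono self_mem_Ici ht ht
  simp only [Pi.sub_apply, id, mul_zero, sub_zero] at h2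
  rw [mul_div_cancel₀ _ h1.ne'] at h2
  have h3 := (abs_le.1 (hf 0 le_rfl)).1
  have h4 := (abs_le.1 (hf _ ht)).2
  linarith

end IsTrajectory

namespace IsBoundedTrajectory

variable {a b : ℝ} {f v w : ℝ → ℝ}

lemma v_pos (h : IsBoundedTrajectory a b f v w) (hb : 0 ≤ b) {t : ℝ} (ht : 0 ≤ t) : 0 < v t := by
  have hanti := h.strictAntiOn_v_Ici hb h.w_zero_neg
  have ht1 : 0 ≤ t + 1 := by linarith
  exact (hanti.antitoneOn.ge_of_tendsto_atTop h.tendsto_v ht1).trans_lt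
    (hanti ht ht1 (by linarith))

lemma strictMonoOn_f (h : IsBoundedTrajectory a b f v w) (hb : 0 ≤ b) : StrictMonoOn f (Ici 0) :=
  strictMonoOn_of_hasDerivWithinAt (convex_Ici 0) h.deriv_f fun _ ht => h.v_pos hb ht

lemma exists_tendsto_f (h : IsBoundedTrajectory a b f v w) (hb : 0 ≤ b) :
    ∃ L, Tendsto f atTop (𝓝 L) := by
  obtain ⟨C, hC⟩ := h.bounded
  exact (h.strictMonoOn_f hb).monotoneOn.exists_tendsto_atTop_of_le
    fun t ht => (abs_le.1 (hC t ht)).2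

lemma f_lt (h : IsBoundedTrajectory a b f v w) (hb : 0 ≤ b) {L : ℝ} (hL : Tendsto f atTop (𝓝 L))
    {t : ℝ} (ht : 0 ≤ t) : f t < L := by
  have ht1 : 0 ≤ t + 1 := by linarith
  exact (h.strictMonoOn_f hb ht ht1 (by linarith)).trans_le
    ((h.strictMonoOn_f hb).monotoneOn.le_of_tendsto_atTop hL ht1)

lemma tendsto_energy (h : IsBoundedTrajectory a b f v w) {L : ℝ} (hL : Tendsto f atTop (𝓝 L)) :
    Tendsto (fun t => v t + a / 2 * f t ^ 2) atTop (𝓝 (a / 2 * L ^ 2)) := by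
  simpa using h.tendsto_v.add ((hL.pow 2).const_mul (a / 2))

lemma tendsto_flux (h : IsBoundedTrajectory a b f v w) (hb : 0 ≤ b) (hab : b ≤ a) :
    Tendsto (fun t => w t + a * f t * v t) atTop (𝓝 0) := by
  obtain ⟨L, hL⟩ := h.exists_tendsto_f hb
  have hE := h.tendsto_energy hL
  have hmono := h.monotoneOn_flux (convex_Ici 0) hab
  -- the energy converges, so on unit intervals its increments, hence the flux, are small
  have hstep : Tendsto (fun t => (v (t + 1) + a / 2 * f (t + 1) ^ 2) - (v t + a / 2 * f t ^ 2))
      atTop (𝓝 0) := by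
    simpa using (hE.comp (tendsto_atTop_add_const_right atTop 1 tendsto_id)).sub hE
  have hmvt : ∀ t, 0 ≤ t → w t + a * f t * v t ≤
      (v (t + 1) + a / 2 * f (t + 1) ^ 2) - (v t + a / 2 * f t ^ 2) ∧
      (v (t + 1) + a / 2 * f (t + 1) ^ 2) - (v t + a / 2 * f t ^ 2) ≤
        w (t + 1) + a * f (t + 1) * v (t + 1) := by
    intro t ht
    have hsub : Icc t (t + 1) ⊆ Ici 0 := fun s hs => ht.trans hs.1
    obtain ⟨c, hc, hceq⟩ := exists_hasDerivAt_eq_slope (fun t => v t + a / 2 * f t ^ 2)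
      (fun t => w t + a * f t * v t) (lt_add_one t)
      (fun s hs => (h.hasDerivWithinAt_energy (hsub hs)).continuousWithinAt.mono hsub)
      (fun s hs => (h.hasDerivWithinAt_energy (hsub ⟨hs.1.le, hs.2.le⟩)).hasDerivAt
        (Ici_mem_nhds (ht.trans_lt hs.1)))
    have hc0 : 0 ≤ c := ht.trans hc.1.le
    rw [add_sub_cancel_left, div_one] at hceq
    rw [← hceq]
    exact ⟨hmono ht hc0 hc.1.le, hmono hc0 (by grind : (0 : ℝ) ≤ t + 1) hc.2.le⟩
  refine tendsto_of_tendsto_of_tendsto_of_le_of_le'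
    (hstep.comp (tendsto_atTop_add_const_right atTop (-1) tendsto_id)) hstep ?_ ?_
  · filter_upwards [eventually_ge_atTop 1] with t ht
    simpa using (hmvt (t + -1) (by linarith)).2
  · filter_upwards [eventually_ge_atTop 0] with t ht using (hmvt t ht).1

lemma flux_nonpos (h : IsBoundedTrajectory a b f v w) (hb : 0 ≤ b) (hab : b ≤ a) {t : ℝ}
    (ht : 0 ≤ t) : w t + a * f t * v t ≤ 0 :=
  (h.monotoneOn_flux (convex_Ici 0) hab).le_of_tendsto_atTop (h.tendsto_flux hb hab) ht

lemma tendsto_w (h : IsBoundedTrajectory a b f v w) (hb : 0 ≤ b) (hab : b ≤ a) :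
    Tendsto w atTop (𝓝 0) := by
  obtain ⟨L, hL⟩ := h.exists_tendsto_f hb
  simpa using (h.tendsto_flux hb hab).sub ((hL.const_mul a).mul h.tendsto_v)

/-- With `L ≤ 0`, `f` would stay negative and `w` would be nonincreasing, which is incompatible with
`w 0 < 0` and `w → 0`. -/
lemma limit_pos (h : IsBoundedTrajectory a b f v w) (ha : 0 ≤ a) (hb : 0 ≤ b) (hab : b ≤ a)
    {L : ℝ} (hL : Tendsto f atTop (𝓝 L)) : 0 < L := by
  by_contra! hL0
  have hw := antitoneOn_of_hasDerivWithinAt (convex_Ici 0) h.deriv_w fun t ht => by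
    have h1 := h.f_lt hb hL ht
    have h2 := h.w_neg_Ici hb h.w_zero_neg ht
    have h3 : 0 ≤ f t * w t := mul_nonneg_of_nonpos_of_nonpos (by linarith) h2.le
    have h4 : 0 ≤ a * (f t * w t) := mul_nonneg ha h3
    have h5 : 0 ≤ b * v t ^ 2 := by positivity
    linarith
  exact (hw.ge_of_tendsto_atTop (h.tendsto_w hb hab) le_rfl).not_gt h.w_zero_neg

lemma antitoneOn_energy (h : IsBoundedTrajectory a b f v w) (hb : 0 ≤ b) (hab : b ≤ a) :
    AntitoneOn (fun t => v t + a / 2 * f t ^ 2) (Ici 0) :=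
  antitoneOn_of_hasDerivWithinAt (convex_Ici 0) (fun _ ht => h.hasDerivWithinAt_energy ht)
    fun _ ht => h.flux_nonpos hb hab ht

lemma le_v (h : IsBoundedTrajectory a b f v w) (hb : 0 ≤ b) (hab : b ≤ a) {L : ℝ}
    (hL : Tendsto f atTop (𝓝 L)) {t : ℝ} (ht : 0 ≤ t) : a / 2 * (L ^ 2 - f t ^ 2) ≤ v t := by
  have := (h.antitoneOn_energy hb hab).ge_of_tendsto_atTop (h.tendsto_energy hL) ht
  linarith

lemma v_le (h : IsBoundedTrajectory a b f v w) (hb : 0 ≤ b) (hab : b ≤ a) {L : ℝ}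
    (hL : Tendsto f atTop (𝓝 L)) {t : ℝ} (ht : 0 ≤ t) : v t ≤ a * L * (L - f t) := by
  -- The `v ^ 2` terms cancel in the derivative. This quantity decreases to 0, so it is nonnegative;
  -- adding `b * v * (L - f)` gives the derivative of `v + a * L * f`.
  have hR : AntitoneOn (fun t => (w t + a * f t * v t) + (a - b) * v t * (L - f t)) (Ici 0) := by
    refine antitoneOn_of_hasDerivWithinAt (convex_Ici 0)
      (f' := fun t => (a - b) * (w t * (L - f t))) (fun t ht => ?_) fun t ht => ?_
    · exact ((h.hasDerivWithinAt_flux ht).add (((h.deriv_v t ht).const_mul (a - b)).mul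
        ((h.deriv_f t ht).const_sub L))).congr_deriv (by ring)
    · exact mul_nonpos_of_nonneg_of_nonpos (sub_nonneg.2 hab)
        (mul_nonpos_of_nonpos_of_nonneg (h.w_neg_Ici hb h.w_zero_neg ht).le
          (sub_nonneg.2 (h.f_lt hb hL ht).le))
  have hRlim : Tendsto (fun t => (w t + a * f t * v t) + (a - b) * v t * (L - f t)) atTop (𝓝 0) := by
    simpa using (h.tendsto_flux hb hab).add ((h.tendsto_v.const_mul (a - b)).mul (hL.const_sub L))
  have hmono : MonotoneOn (fun t => v t + a * L * f t) (Ici 0) := by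
    refine monotoneOn_of_hasDerivWithinAt (convex_Ici 0)
      (fun t ht => (h.deriv_v t ht).add ((h.deriv_f t ht).const_mul (a * L))) fun t ht => ?_
    have h1 := hR.ge_of_tendsto_atTop hRlim ht
    have h2 : 0 ≤ b * (v t * (L - f t)) :=
      mul_nonneg hb (mul_nonneg (h.v_pos hb ht).le (sub_nonneg.2 (h.f_lt hb hL ht).le))
    linarith
  have hlim : Tendsto (fun t => v t + a * L * f t) atTop (𝓝 (a * L * L)) := by
    simpa using h.tendsto_v.add (hL.const_mul (a * L))
  have := hmono.le_of_tendsto_atTop hlim ht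
  linarith

lemma rescale (h : IsBoundedTrajectory a b f v w) {κ : ℝ} (hκ : 0 < κ) :
    IsBoundedTrajectory a b (fun t => κ * f (κ * t)) (fun t => κ ^ 2 * v (κ * t))
      (fun t => κ ^ 3 * w (κ * t)) := by
  obtain ⟨C, hC⟩ := h.bounded
  refine ⟨h.toIsTrajectory.rescale hκ, ?_, ⟨κ * C, fun t ht => ?_⟩, ?_⟩
  · rw [mul_zero]
    exact mul_neg_of_pos_of_neg (pow_pos hκ 3) h.w_zero_neg
  · rw [abs_mul, abs_of_pos hκ]
    exact mul_le_mul_of_nonneg_left (hC _ (mul_nonneg hκ.le ht)) hκ.le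
  · simpa using (h.tendsto_v.comp (tendsto_id.const_mul_atTop hκ)).const_mul (κ ^ 2)

lemma shift (h : IsBoundedTrajectory a b f v w) (hb : 0 ≤ b) {c : ℝ} (hc : 0 ≤ c) :
    IsBoundedTrajectory a b (fun t => f (c + t)) (fun t => v (c + t)) (fun t => w (c + t)) := by
  obtain ⟨C, hC⟩ := h.bounded
  refine ⟨h.toIsTrajectory.shift hc, ?_, ⟨C, fun t ht => hC _ (add_nonneg hc ht)⟩,
    h.tendsto_v.comp (tendsto_atTop_add_const_left _ c tendsto_id)⟩
  rw [add_zero]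
  exact h.w_neg_Ici hb h.w_zero_neg hc

/-- `w / f ^ 3` is invariant under the scaling `κ * f (κ * t)`; its strict growth is what detects a
time shift in `slope_eq_of_limit_le`. -/
lemma strictMonoOn_ratio (h : IsBoundedTrajectory a b f v w) (ha : 0 < a) (hb : 0 ≤ b)
    (hab : b ≤ a) (hf0 : 0 < f 0) : StrictMonoOn (fun t => w t / f t ^ 3) (Ici 0) := by
  have hf : ∀ t, 0 ≤ t → 0 < f t := fun t ht =>
    hf0.trans_le ((h.strictMonoOn_f hb).monotoneOn self_mem_Ici ht ht)
  refine strictMonoOn_of_hasDerivWithinAt (convex_Ici 0)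
    (fun t ht => (h.deriv_w t ht).div ((h.deriv_f t ht).pow 3) (pow_pos (hf t ht) 3).ne')
    fun t ht => div_pos ?_ (by have := hf t ht; positivity)
  have h1 := hf t ht
  have h2 := h.v_pos hb ht
  have h3 := h.w_neg_Ici hb h.w_zero_neg ht
  have h4 := h.flux_nonpos hb hab ht
  have h5 : 0 < a * f t ^ 2 * (-w t) := by
    have : 0 < -w t := by linarith
    positivity
  have h6 : 0 ≤ v t * (-w t - a * f t * v t) := mul_nonneg h2.le (by linarith)
  have h7 : 0 ≤ (3 * a - b) * (f t * v t ^ 2) :=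
    mul_nonneg (by linarith) (by positivity)
  -- The numerator of the derivative, with `-3 v w` split as `3 v (-w - a f v) + 3 a f v ^ 2` so
  -- that each summand has a sign.
  have h8 : 0 < f t ^ 2 * (a * f t ^ 2 * (-w t) + 3 * (v t * (-w t - a * f t * v t))
      + (3 * a - b) * (f t * v t ^ 2)) := mul_pos (pow_pos h1 2) (by linarith)
  push_cast
  linarith

end IsBoundedTrajectory

/-! ### Comparison of profiles in Crocco variables -/

/-- Crocco variables: along an increasing bounded trajectory with limit `L`, the slope `y` and the
second derivative `P` are functions of the position `x ∈ [x₀, L)`. -/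
structure IsProfile (a b x₀ L : ℝ) (y P : ℝ → ℝ) : Prop where
  continuousOn_y : ContinuousOn y (Ico x₀ L)
  continuousOn_P : ContinuousOn P (Ico x₀ L)
  deriv_y : ∀ x ∈ Ioo x₀ L, HasDerivAt y (P x / y x) x
  deriv_P : ∀ x ∈ Ioo x₀ L, HasDerivAt P ((-a * x * P x - b * y x ^ 2) / y x) x
  pos : ∀ x ∈ Ico x₀ L, 0 < y x
  tendsto_y : Tendsto y (𝓝[<] L) (𝓝 0)
  tendsto_P : Tendsto P (𝓝[<] L) (𝓝 0)
  lower : ∀ x ∈ Ico x₀ L, a / 2 * (L ^ 2 - x ^ 2) ≤ y x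
  upper : ∀ x ∈ Ico x₀ L, y x ≤ a * L * (L - x)

lemma MonotoneOn.le_of_tendsto_nhdsLT {x₀ L l : ℝ} {f : ℝ → ℝ} (hf : MonotoneOn f (Ico x₀ L))
    (hl : Tendsto f (𝓝[<] L) (𝓝 l)) {x : ℝ} (hx : x ∈ Ico x₀ L) : f x ≤ l :=
  ge_of_tendsto hl (by
    filter_upwards [Ioo_mem_nhdsLT hx.2] with z hz using hf hx ⟨hx.1.trans hz.1.le, hz.2⟩ hz.1.le)

lemma AntitoneOn.ge_of_tendsto_nhdsLT {x₀ L l : ℝ} {f : ℝ → ℝ} (hf : AntitoneOn f (Ico x₀ L))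
    (hl : Tendsto f (𝓝[<] L) (𝓝 l)) {x : ℝ} (hx : x ∈ Ico x₀ L) : l ≤ f x :=
  le_of_tendsto hl (by
    filter_upwards [Ioo_mem_nhdsLT hx.2] with z hz using hf hx ⟨hx.1.trans hz.1.le, hz.2⟩ hz.1.le)

namespace IsProfile

variable {a b x₀ L : ℝ} {y P y' P' : ℝ → ℝ}

/-- If one profile is at most `θ` times another, so are the (negated) second derivatives, and hence
the squares of the profiles. -/
lemma comparison_step (h : IsProfile a b x₀ L y P) (h' : IsProfile a b x₀ L y' P') (ha : 0 ≤ a)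
    (hab : b ≤ a) (hx₀ : 0 ≤ x₀) {θ : ℝ} (hθ : ∀ x ∈ Ico x₀ L, y' x ≤ θ * y x) :
    ∀ x ∈ Ico x₀ L, θ * P x ≤ P' x ∧ y' x ^ 2 ≤ θ * y x ^ 2 := by
  have hIoo : interior (Ico x₀ L) = Ioo x₀ L := interior_Ico
  have hlimx : Tendsto (fun x : ℝ => a * x) (𝓝[<] L) (𝓝 (a * L)) :=
    ((continuous_const.mul continuous_id).tendsto L).mono_left nhdsWithin_le_nhds
  -- In the variable `x` the flux `P + a x y` has derivative `(a - b) y`, so an inequality between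
  -- profiles passes to fluxes by integrating back from `L`, where both vanish.
  have hD : AntitoneOn (fun x => (P' x + a * x * y' x) - θ * (P x + a * x * y x)) (Ico x₀ L) := by
    have hcx : ContinuousOn (fun x : ℝ => a * x) (Ico x₀ L) := by fun_prop
    refine antitoneOn_of_hasDerivWithinAt_nonpos (f' := fun x => (a - b) * (y' x - θ * y x))
      (convex_Ico x₀ L)
      ((h'.continuousOn_P.add (hcx.mul h'.continuousOn_y)).sub
        (continuousOn_const.mul (h.continuousOn_P.add (hcx.mul h.continuousOn_y))))
      (fun x hx => ?_) fun x hx => ?_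
    · rw [hIoo] at hx ⊢
      have h1 := h.pos x (Ioo_subset_Ico_self hx)
      have h2 := h'.pos x (Ioo_subset_Ico_self hx)
      have hid := (hasDerivAt_id x).const_mul a
      refine ((((h'.deriv_P x hx).add (hid.mul (h'.deriv_y x hx))).sub
        (((h.deriv_P x hx).add (hid.mul (h.deriv_y x hx))).const_mul θ)).congr_deriv
          ?_).hasDerivWithinAt
      simp only [id]
      field_simp
      ring
    · rw [hIoo] at hx
      exact mul_nonpos_of_nonneg_of_nonpos (sub_nonneg.2 hab)
        (sub_nonpos.2 (hθ x (Ioo_subset_Ico_self hx)))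
  have hDlim : Tendsto (fun x => (P' x + a * x * y' x) - θ * (P x + a * x * y x))
      (𝓝[<] L) (𝓝 0) := by
    simpa using (h'.tendsto_P.add (hlimx.mul h'.tendsto_y)).sub
      ((h.tendsto_P.add (hlimx.mul h.tendsto_y)).const_mul θ)
  have hP : ∀ x ∈ Ico x₀ L, θ * P x ≤ P' x := fun x hx => by
    have h1 := hD.ge_of_tendsto_nhdsLT hDlim hx
    have h2 : 0 ≤ a * x * (θ * y x - y' x) :=
      mul_nonneg (mul_nonneg ha (hx₀.trans hx.1)) (sub_nonneg.2 (hθ x hx))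
    linarith
  -- Since `(y ^ 2)' = 2 P`, the factor `θ` between the `P`'s becomes a factor `θ` between the
  -- squares.
  have hH : MonotoneOn (fun x => y' x ^ 2 - θ * y x ^ 2) (Ico x₀ L) := by
    refine monotoneOn_of_hasDerivWithinAt_nonneg (f' := fun x => 2 * (P' x - θ * P x))
      (convex_Ico x₀ L)
      ((h'.continuousOn_y.pow 2).sub (continuousOn_const.mul (h.continuousOn_y.pow 2)))
      (fun x hx => ?_) fun x hx => ?_
    · rw [hIoo] at hx ⊢
      have h1 := h.pos x (Ioo_subset_Ico_self hx)
      have h2 := h'.pos x (Ioo_subset_Ico_self hx)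
      refine ((((h'.deriv_y x hx).pow 2).sub (((h.deriv_y x hx).pow 2).const_mul θ)).congr_deriv
          ?_).hasDerivWithinAt
      push_cast
      field_simp
    · rw [hIoo] at hx
      have := hP x (Ioo_subset_Ico_self hx)
      linarith
  have hHlim : Tendsto (fun x => y' x ^ 2 - θ * y x ^ 2) (𝓝[<] L) (𝓝 0) := by
    simpa using (h'.tendsto_y.pow 2).sub ((h.tendsto_y.pow 2).const_mul θ)
  exact fun x hx => ⟨hP x hx, sub_nonpos.1 (hH.le_of_tendsto_nhdsLT hHlim hx)⟩

/-- Iterating `comparison_step` drives the factor to 1, because `1 + ε ≤ (1 + ε / 2) ^ 2`. The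
initial factor 2 comes from `upper` and `lower`, as `L ≤ L + x` for `x ≥ 0`. -/
lemma le_of_isProfile (h : IsProfile a b x₀ L y P) (h' : IsProfile a b x₀ L y' P') (ha : 0 ≤ a)
    (hab : b ≤ a) (hx₀ : 0 ≤ x₀) : ∀ x ∈ Ico x₀ L, y' x ≤ y x := by
  have key : ∀ n : ℕ, ∀ x ∈ Ico x₀ L, y' x ≤ (1 + (1 / 2) ^ n) * y x := by
    intro n
    induction n with
    | zero =>
      intro x hx
      have h1 := h.lower x hx
      have h2 := h'.upper x hx
      have h3 : 0 ≤ a * (L - x) * x :=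
        mul_nonneg (mul_nonneg ha (sub_nonneg.2 hx.2.le)) (hx₀.trans hx.1)
      rw [pow_zero]
      nlinarith
    | succ n ih =>
      intro x hx
      have h1 := ((h.comparison_step h' ha hab hx₀ ih) x hx).2
      have h2 := h.pos x hx
      have hε : (0 : ℝ) < (1 / 2) ^ n := by positivity
      refine le_of_sq_le_sq (h1.trans ?_) (by positivity)
      rw [mul_pow, pow_succ (1 / 2 : ℝ) n]
      refine mul_le_mul_of_nonneg_right ?_ (sq_nonneg _)
      nlinarith
  intro x hx
  have hlim : Tendsto (fun n : ℕ => (1 + (1 / 2 : ℝ) ^ n) * y x) atTop (𝓝 (y x)) := by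
    have := (tendsto_pow_atTop_nhds_zero_of_lt_one (r := (1 / 2 : ℝ)) (by norm_num)
      (by norm_num)).const_add 1 |>.mul_const (y x)
    simpa using this
  exact ge_of_tendsto' hlim fun n => key n x hx

lemma second_le (h : IsProfile a b x₀ L y P) (h' : IsProfile a b x₀ L y' P') (ha : 0 ≤ a)
    (hab : b ≤ a) (hx₀ : 0 ≤ x₀) : ∀ x ∈ Ico x₀ L, P x ≤ P' x := fun x hx => by
  have := (h.comparison_step h' ha hab hx₀ (θ := 1)
    (fun x hx => by simpa using h.le_of_isProfile h' ha hab hx₀ x hx) x hx).1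
  rwa [one_mul] at this

end IsProfile

/-! ### Uniqueness of bounded trajectories -/

namespace IsBoundedTrajectory

variable {a b : ℝ} {f v w g p q : ℝ → ℝ}

lemma exists_eq (h : IsBoundedTrajectory a b f v w) {L : ℝ} (hL : Tendsto f atTop (𝓝 L)) {x : ℝ}
    (hx : x ∈ Ico (f 0) L) : ∃ t, 0 ≤ t ∧ f t = x := by
  obtain ⟨T, hT, hT0⟩ := ((hL.eventually_const_lt hx.2).and (eventually_ge_atTop 0)).exists
  obtain ⟨t, ht, rfl⟩ := intermediate_value_Icc hT0
    (h.continuousOn_f.mono Icc_subset_Ici_self) ⟨hx.1, hT.le⟩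
  exact ⟨t, ht.1, rfl⟩

/-- As `f` increases strictly from `f 0` towards `L`, time is a function `σ` of position with `σ' =
1 / v`; the profiles are `v ∘ σ` and `w ∘ σ`. -/
lemma exists_isProfile (h : IsBoundedTrajectory a b f v w) (hb : 0 ≤ b) (hab : b ≤ a) {L : ℝ}
    (hL : Tendsto f atTop (𝓝 L)) :
    ∃ y P, IsProfile a b (f 0) L y P ∧ y (f 0) = v 0 ∧ P (f 0) = w 0 := by
  have hex : ∀ x, ∃ t, x ∈ Ico (f 0) L → 0 ≤ t ∧ f t = x := fun x => by
    by_cases hx : x ∈ Ico (f 0) L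
    · obtain ⟨t, ht⟩ := h.exists_eq hL hx
      exact ⟨t, fun _ => ht⟩
    · exact ⟨0, fun h => absurd h hx⟩
  choose σ hσ using hex
  have hf := h.strictMonoOn_f hb
  have hmem : ∀ t, 0 ≤ t → f t ∈ Ico (f 0) L := fun t ht =>
    ⟨hf.monotoneOn self_mem_Ici ht ht, h.f_lt hb hL ht⟩
  have hσf : ∀ t, 0 ≤ t → σ (f t) = t := fun t ht =>
    hf.injOn (hσ _ (hmem t ht)).1 ht (hσ _ (hmem t ht)).2
  have hσmono : StrictMonoOn σ (Ico (f 0) L) := fun x hx z hz hxz => by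
    rw [← (hσ x hx).2, ← (hσ z hz).2] at hxz
    exact (hf.lt_iff_lt (hσ x hx).1 (hσ z hz).1).1 hxz
  have himage : Ici 0 ⊆ σ '' Ico (f 0) L := fun t ht => ⟨f t, hmem t ht, hσf t ht⟩
  have hσpos : ∀ x ∈ Ioo (f 0) L, 0 < σ x := fun x hx => by
    have := hσmono (hmem 0 le_rfl) (Ioo_subset_Ico_self hx) hx.1
    rwa [hσf 0 le_rfl] at this
  have hσat : ∀ x ∈ Ioo (f 0) L, ContinuousAt σ x := fun x hx =>
    hσmono.continuousAt_of_image_mem_nhds (Ico_mem_nhds hx.1 hx.2)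
      (mem_of_superset (Ici_mem_nhds (hσpos x hx)) himage)
  have hσcont : ContinuousOn σ (Ico (f 0) L) := fun x hx => by
    rcases hx.1.eq_or_lt with rfl | h1
    · refine (hσmono.continuousWithinAt_right_of_surjOn (Ico_mem_nhdsGE hx.2)
        fun t ht => ?_).mono Ico_subset_Ici_self
      rw [hσf 0 le_rfl] at ht
      exact himage (le_of_lt (mem_Ioi.1 ht) : (0 : ℝ) ≤ t)
    · exact (hσat x ⟨h1, hx.2⟩).continuousWithinAt
  have hσmaps : MapsTo σ (Ico (f 0) L) (Ici 0) := fun x hx => (hσ x hx).1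
  have hσderiv : ∀ x ∈ Ioo (f 0) L, HasDerivAt σ (v (σ x))⁻¹ x := fun x hx =>
    HasDerivAt.of_local_left_inverse (hσat x hx)
      ((h.deriv_f _ (hσpos x hx).le).hasDerivAt (Ici_mem_nhds (hσpos x hx)))
      (h.v_pos hb (hσpos x hx).le).ne'
      (by filter_upwards [Ico_mem_nhds hx.1 hx.2] with z hz using (hσ z hz).2)
  have hσlim : Tendsto σ (𝓝[<] L) atTop := by
    refine tendsto_atTop.2 fun c => ?_
    have h0 : 0 ≤ max c 0 := le_max_right _ _
    filter_upwards [Ioo_mem_nhdsLT (h.f_lt hb hL h0)] with x hx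
    have := hσmono (hmem _ h0) ⟨(hmem _ h0).1.trans hx.1.le, hx.2⟩ hx.1
    rw [hσf _ h0] at this
    exact (le_max_left _ _).trans this.le
  refine ⟨fun x => v (σ x), fun x => w (σ x), ?_, congrArg v (hσf 0 le_rfl), congrArg w (hσf 0 le_rfl)⟩
  refine ⟨h.continuousOn_v.comp hσcont hσmaps, h.continuousOn_w.comp hσcont hσmaps,
    fun x hx => ?_, fun x hx => ?_, fun x hx => h.v_pos hb (hσ x hx).1,
    h.tendsto_v.comp hσlim, (h.tendsto_w hb hab).comp hσlim, fun x hx => ?_, fun x hx => ?_⟩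
  · have hn := Ici_mem_nhds (hσpos x hx)
    exact (((h.deriv_v _ (hσpos x hx).le).hasDerivAt hn).comp x (hσderiv x hx)).congr_deriv
      (div_eq_mul_inv _ _).symm
  · have hn := Ici_mem_nhds (hσpos x hx)
    refine (((h.deriv_w _ (hσpos x hx).le).hasDerivAt hn).comp x (hσderiv x hx)).congr_deriv ?_
    rw [(hσ x (Ioo_subset_Ico_self hx)).2, div_eq_mul_inv]
  · have := h.le_v hb hab hL (hσ x hx).1
    rwa [(hσ x hx).2] at this
  · have := h.v_le hb hab hL (hσ x hx).1
    rwa [(hσ x hx).2] at this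

/-- Bounded trajectories with the same nonnegative start and the same limit have the same initial
data. -/
lemma data_eq_of_limit_eq (h : IsBoundedTrajectory a b f v w) (h' : IsBoundedTrajectory a b g p q)
    (ha : 0 ≤ a) (hb : 0 ≤ b) (hab : b ≤ a) (h0 : f 0 = g 0) (hf0 : 0 ≤ f 0) {L : ℝ}
    (hL : Tendsto f atTop (𝓝 L)) (hL' : Tendsto g atTop (𝓝 L)) : v 0 = p 0 ∧ w 0 = q 0 := by
  obtain ⟨y, P, hy, hy0, hP0⟩ := h.exists_isProfile hb hab hL
  obtain ⟨z, R, hz, hz0, hR0⟩ := h'.exists_isProfile hb hab hL'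
  rw [← h0] at hz hz0 hR0
  have hx : f 0 ∈ Ico (f 0) L := ⟨le_rfl, h.f_lt hb hL le_rfl⟩
  rw [← hy0, ← hz0, ← hP0, ← hR0]
  exact ⟨le_antisymm (hz.le_of_isProfile hy ha hab hf0 _ hx)
    (hy.le_of_isProfile hz ha hab hf0 _ hx),
    le_antisymm (hy.second_le hz ha hab hf0 _ hx) (hz.second_le hy ha hab hf0 _ hx)⟩

/-- Scaling `f` by `κ = L' / L ≥ 1` matches the limits and moves the start to `κ * f 0 ≥ g 0`, a
point that `g` reaches at some time `t`. Equality of data there forces `t = 0` and `κ = 1`. -/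
lemma slope_eq_of_limit_le (h : IsBoundedTrajectory a b f v w)
    (h' : IsBoundedTrajectory a b g p q) (ha : 0 < a) (hb : 0 ≤ b) (hab : b ≤ a) (h0 : f 0 = g 0)
    (hf0 : 0 ≤ f 0) (hwq : w 0 = q 0) {L L' : ℝ} (hL : Tendsto f atTop (𝓝 L))
    (hL' : Tendsto g atTop (𝓝 L')) (hLL : L ≤ L') : v 0 = p 0 := by
  have hLpos := h.limit_pos ha.le hb hab hL
  set κ := L' / L
  have hκ1 : 1 ≤ κ := (one_le_div hLpos).2 hLL
  have hκ : 0 < κ := one_pos.trans_le hκ1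
  have hκL : κ * L = L' := div_mul_cancel₀ _ hLpos.ne'
  have hx : κ * f 0 ∈ Ico (g 0) L' := by
    refine ⟨?_, ?_⟩
    · rw [← h0]
      exact le_mul_of_one_le_left hf0 hκ1
    · rw [← hκL]
      exact mul_lt_mul_of_pos_left (h.f_lt hb hL le_rfl) hκ
  obtain ⟨t, ht, hgt⟩ := h'.exists_eq hL' hx
  have hlim : Tendsto (fun t => κ * f (κ * t)) atTop (𝓝 L') := by
    rw [← hκL]
    exact (hL.comp (tendsto_id.const_mul_atTop hκ)).const_mul κ
  obtain ⟨hv, hw⟩ := (h.rescale hκ).data_eq_of_limit_eq (h'.shift hb ht) ha.le hb hab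
    (by simp [hgt]) (by rw [mul_zero]; positivity) hlim
    (hL'.comp (tendsto_atTop_add_const_left _ t tendsto_id))
  simp only [mul_zero, add_zero] at hv hw
  -- If `g 0 = 0`, the point `κ * f 0` is the start itself. Otherwise scale invariance gives `q / g
  -- ^ 3` the same value at `0` and at `t`.
  have ht0 : t = 0 := by
    by_contra hne
    have htpos : 0 < t := lt_of_le_of_ne ht (Ne.symm hne)
    have hglt := h'.strictMonoOn_f hb self_mem_Ici ht htpos
    have hg0 : 0 < g 0 := by
      refine lt_of_le_of_ne (h0 ▸ hf0) fun h00 => ?_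
      rw [hgt, h0, ← h00, mul_zero] at hglt
      exact lt_irrefl _ hglt
    have hr := h'.strictMonoOn_ratio ha hb hab hg0 self_mem_Ici ht htpos
    simp only [hgt, ← hw, h0, mul_pow, hwq] at hr
    rw [mul_div_mul_left _ _ (pow_pos hκ 3).ne'] at hr
    exact lt_irrefl _ hr
  rw [ht0] at hw hv
  have hq0 := h'.w_zero_neg
  have hκ3 : κ ^ 3 = 1 := by
    rw [hwq] at hw
    exact mul_right_cancel₀ hq0.ne (hw.trans (one_mul _).symm)
  have hκe : κ = 1 := (pow_eq_one_iff_of_nonneg hκ.le (by norm_num)).1 hκ3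
  rw [← hv, hκe]
  ring

/-- A bounded trajectory with nonnegative start is determined by its start and its initial second
derivative. -/
lemma eqOn (h : IsBoundedTrajectory a b f v w) (h' : IsBoundedTrajectory a b g p q) (ha : 0 < a)
    (hb : 0 ≤ b) (hab : b ≤ a) (h0 : f 0 = g 0) (hf0 : 0 ≤ f 0) (hwq : w 0 = q 0) :
    EqOn f g (Ici 0) := by
  obtain ⟨L, hL⟩ := h.exists_tendsto_f hb
  obtain ⟨L', hL'⟩ := h'.exists_tendsto_f hb
  have hv : v 0 = p 0 := by
    rcases le_total L L' with hl | hl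
    · exact h.slope_eq_of_limit_le h' ha hb hab h0 hf0 hwq hL hL' hl
    · exact (h'.slope_eq_of_limit_le h ha hb hab h0.symm (h0 ▸ hf0) hwq.symm hL' hL hl).symm
  have := h.isIntegralCurveOn.eqOn_Ici (contDiff_flowField a b) h'.isIntegralCurveOn
    (by simp [h0, hv, hwq])
  exact fun t ht => congrArg Prod.fst (this ht)

end IsBoundedTrajectory

/-! ### Trajectories versus solutions of the boundary value problem -/

namespace IsTrajectory

variable {a b : ℝ} {f v w : ℝ → ℝ}

lemma derivWithin_eqOn (h : IsTrajectory a b (Ici 0) f v w) :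
    EqOn (derivWithin f (Ici 0)) v (Ici 0) := fun t ht =>
  (h.deriv_f t ht).derivWithin (uniqueDiffOn_Ici 0 t ht)

lemma iteratedDerivWithin_two_eqOn (h : IsTrajectory a b (Ici 0) f v w) :
    EqOn (iteratedDerivWithin 2 f (Ici 0)) w (Ici 0) := fun t ht => by
  rw [iteratedDerivWithin_succ, iteratedDerivWithin_one,
    derivWithin_congr h.derivWithin_eqOn (h.derivWithin_eqOn ht)]
  exact (h.deriv_v t ht).derivWithin (uniqueDiffOn_Ici 0 t ht)

lemma iteratedDerivWithin_three_eqOn (h : IsTrajectory a b (Ici 0) f v w) :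
    EqOn (iteratedDerivWithin 3 f (Ici 0)) (fun t => -a * f t * w t - b * v t ^ 2) (Ici 0) :=
  fun t ht => by
  rw [iteratedDerivWithin_succ,
    derivWithin_congr h.iteratedDerivWithin_two_eqOn (h.iteratedDerivWithin_two_eqOn ht)]
  exact (h.deriv_w t ht).derivWithin (uniqueDiffOn_Ici 0 t ht)

lemma contDiffOn (h : IsTrajectory a b (Ici 0) f v w) : ContDiffOn ℝ 3 f (Ici 0) := by
  have hf : DifferentiableOn ℝ f (Ici 0) := fun t ht => (h.deriv_f t ht).differentiableWithinAt
  have hv : DifferentiableOn ℝ v (Ici 0) := fun t ht => (h.deriv_v t ht).differentiableWithinAt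
  have hw : DifferentiableOn ℝ w (Ici 0) := fun t ht => (h.deriv_w t ht).differentiableWithinAt
  refine contDiffOn_of_differentiableOn_deriv (n := 3) fun k hk => ?_
  have hk : k ≤ 3 := by exact_mod_cast hk
  interval_cases k
  · rwa [iteratedDerivWithin_zero]
  · rw [iteratedDerivWithin_one]
    exact hv.congr h.derivWithin_eqOn
  · exact hw.congr h.iteratedDerivWithin_two_eqOn
  · exact (((hf.const_mul (-a)).mul hw).sub ((hv.pow 2).const_mul b)).congr
      h.iteratedDerivWithin_three_eqOn

end IsTrajectory

lemma IsBoundedTrajectory.isBoundedSolution {m γ : ℝ} {f v w : ℝ → ℝ}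
    (h : IsBoundedTrajectory (m + 2) (-(2 * m + 1)) f v w) (h0 : f 0 = -γ) (hw : w 0 = -1) :
    IsBoundedSolution m γ f := by
  refine ⟨⟨h.contDiffOn, fun t ht => ?_, h0, h.tendsto_v.congr' ?_, ?_⟩, h.bounded⟩
  · rw [h.iteratedDerivWithin_three_eqOn ht, h.iteratedDerivWithin_two_eqOn ht,
      h.derivWithin_eqOn ht]
    ring
  · filter_upwards [eventually_ge_atTop 0] with t ht using (h.derivWithin_eqOn ht).symm
  · rw [h.iteratedDerivWithin_two_eqOn self_mem_Ici, hw]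

lemma IsBoundedSolution.isBoundedTrajectory {m γ : ℝ} {g : ℝ → ℝ} (h : IsBoundedSolution m γ g) :
    IsBoundedTrajectory (m + 2) (-(2 * m + 1)) g (derivWithin g (Ici 0))
      (iteratedDerivWithin 2 g (Ici 0)) := by
  obtain ⟨hs, hC⟩ := h
  have hu := uniqueDiffOn_Ici (0 : ℝ)
  have hd (k : ℕ) (hk : k < 3) : ∀ t ∈ Ici (0 : ℝ),
      HasDerivWithinAt (iteratedDerivWithin k g (Ici 0)) (iteratedDerivWithin (k + 1) g (Ici 0) t)
        (Ici 0) t := fun t ht => by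
    rw [iteratedDerivWithin_succ]
    exact (hs.contDiffOn.differentiableOn_iteratedDerivWithin (by exact_mod_cast hk) hu t
      ht).hasDerivWithinAt
  refine ⟨⟨?_, ?_, fun t ht => ?_⟩, ?_, hC, hs.deriv_infty⟩
  · have := hd 0 (by norm_num)
    rwa [zero_add, iteratedDerivWithin_zero, iteratedDerivWithin_one] at this
  · have := hd 1 (by norm_num)
    rwa [iteratedDerivWithin_one] at this
  · exact (hd 2 (by norm_num) t ht).congr_deriv (by linarith [hs.equation t ht])
  · rw [hs.second_deriv_zero]
    norm_num

theorem mainTheorem6 (m γ : ℝ) (hm : -1 < m) (hm' : m ≤ -(1 / 2)) :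
    ∃ f : ℝ → ℝ, IsBoundedSolution m γ f ∧
      (∀ᶠ t in atTop, 0 < f t) ∧
      StrictMonoOn f (Ici 0) ∧
      StrictConcaveOn ℝ (Ici 0) f ∧
      (∀ t : ℝ, 0 ≤ t →
        -γ ≤ f t ∧ f t ≤ Real.sqrt (γ ^ 2 + 2 * derivWithin f (Ici 0) 0 / (m + 2))) ∧
      (γ ≤ 0 → ∀ g : ℝ → ℝ, IsBoundedSolution m γ g → EqOn g f (Ici 0)) := by
  have ha : 0 < m + 2 := by linarith
  have hb : 0 ≤ -(2 * m + 1) := by linarith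
  have hab : -(2 * m + 1) < m + 2 := by linarith
  obtain ⟨f, v, w, htr, hf0, hw0, hv, hQ⟩ := exists_trajectory ha hb hab (-γ)
  have hwneg : w 0 < 0 := by rw [hw0]; norm_num
  have h := htr.isBoundedTrajectory ha hb hwneg hv hQ
  obtain ⟨L, hL⟩ := h.exists_tendsto_f hb
  refine ⟨f, h.isBoundedSolution hf0 hw0,
    hL.eventually_const_lt (h.limit_pos ha.le hb hab.le hL), h.strictMonoOn_f hb, ?_,
    fun t ht => ⟨?_, ?_⟩, fun hγ g hg => ?_⟩
  · refine StrictAntiOn.strictConcaveOn_of_deriv (convex_Ici 0) h.continuousOn_f ?_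
    rw [interior_Ici]
    refine ((h.strictAntiOn_v_Ici hb hwneg).mono Ioi_subset_Ici_self).congr fun t ht => ?_
    exact ((h.deriv_f t (Ioi_subset_Ici_self ht)).hasDerivAt (Ici_mem_nhds ht)).deriv.symm
  · rw [← hf0]
    exact (h.strictMonoOn_f hb).monotoneOn self_mem_Ici ht ht
  -- Energy decay from `0` to `t`, with the positive slope `v t` dropped.
  · refine Real.le_sqrt_of_sq_le ?_
    have h1 := h.antitoneOn_energy hb hab.le self_mem_Ici ht ht
    have h2 := h.v_pos hb ht
    rw [h.derivWithin_eqOn self_mem_Ici]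
    simp only [hf0] at h1
    rw [← sub_le_iff_le_add', le_div_iff₀ ha]
    linarith
  · have hg' := hg.isBoundedTrajectory
    exact hg'.eqOn h ha hb hab.le (by rw [hg.1.value_zero, hf0])
      (by rw [hg.1.value_zero]; linarith) (by rw [hg.1.second_deriv_zero, hw0])
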